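/- \textbf{Theorem.} Let $S(0,1)$ be the space of (a.e. equivalence classes of) real measurable functions on $(0,1)$ with Lebesgue measure $m$, and for $x\in S(0,1)$ let $\mu(t;x)=\inf\{s\ge 0:\ m(\{u\in(0,1):|x(u)|>s\})\le t\}$ be its decreasing rearrangement. A \emph{symmetric quasi-Banach function space} on $(0,1)$ is a linear subspace $E\subset S(0,1)$ with a complete quasi-norm $\|\cdot\|_E$ such that (a) if $x\in E$, $y\in S(0,1)$ and $|y|\le |x|$ a.e., then $y\in E$ and $\|y\|_E\le\|x\|_E$; (b) if $x\in E$, $y\in S(0,1)$ and $\mu(y)=\mu(x)$, then $y\in E$ and $\|y\|_E=\|x\|_E$. Let $S$ be the Calder\'on operator $$(Sx)(t)=\frac1t\int_0^t x(s)\,ds+\int_t^1\frac{x(s)}{s}\,ds,\qquad 0<t<1,\ x\in L_1(0,1),$$ and let $L_{1,\infty}$ be the set of all $x\in S(0,1)$ with $\sup_{0<t\le 1}t\,\mu(t;x)<\infty$. Let $E\subset L_1(0,1)$ be a symmetric quasi-Banach function space on $(0,1)$, and put $$\mathcal S_E=\{x\in L_{1,\infty}:\ \exists\, y\in E,\ \mu(x)\le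 S\mu(y)\ \text{on }(0,1)\},\qquad \|x\|_{\mathcal S_E}=\inf\{\|y\|_E:\ y\in E,\ \mu(x)\le S\mu(y)\ \text{on }(0,1)\}.$$ Then: (i) $(\mathcal S_E,\|\cdot\|_{\mathcal S_E})$ is a symmetric quasi-Banach function space on $(0,1)$. (ii) $\mathcal S_E$ is the optimal symmetric quasi-Banach range of $S$ on $E$. That is, $S$ maps $E$ boundedly into $\mathcal S_E$, and for every symmetric quasi-Banach function space $F$ on $(0,1)$ such that $S$ maps $E$ boundedly into $F$, one has $\mathcal S_E\subset F$ and there is a constant $C$ with $\|x\|_F\le C\|x\|_{\mathcal S_E}$ for all $x\in\mathcal S_E$. -/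

import Mathlib

open MeasureTheory Set Filter Topology

noncomputable section

namespace CalderonRange

/-- Lebesgue measure on the interval `(0,1)`. -/
abbrev leb : Measure ℝ := volume.restrict (Ioo (0 : ℝ) 1)

/-- The space `S(0,1)` of classes (modulo a.e. equality) of real measurable functions on `(0,1)`. -/
abbrev S01 : Type := ℝ →ₘ[leb] ℝ

/-- The decreasing right-continuous rearrangement
`μ(t; x) = inf {s ≥ 0 : m {u ∈ (0,1) : |x u| > s} ≤ t}`; the set is nonempty for `t > 0`. -/
def rearr (x : S01) (t : ℝ) : ℝ :=
  sInf {s : ℝ | 0 ≤ s ∧ leb {u : ℝ | s < |x u|} ≤ ENNReal.ofReal t}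

/-- A quasi-normed linear subspace of `S(0,1)`: `E` is the carrier, and the quasi-norm is the
restriction of `N` to `E` (the values of `N` outside `E` are irrelevant). -/
structure IsQuasiNormed (E : Set S01) (N : S01 → ℝ) : Prop where
  zero_mem : (0 : S01) ∈ E
  add_mem : ∀ x ∈ E, ∀ y ∈ E, x + y ∈ E
  smul_mem : ∀ (c : ℝ), ∀ x ∈ E, c • x ∈ E
  nonneg : ∀ x ∈ E, 0 ≤ N x
  eq_zero_iff : ∀ x ∈ E, (N x = 0 ↔ x = 0)
  norm_smul : ∀ (c : ℝ), ∀ x ∈ E, N (c • x) = |c| * N x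
  quasi_triangle : ∃ K : ℝ, ∀ x ∈ E, ∀ y ∈ E, N (x + y) ≤ K * (N x + N y)

/-- Completeness: every Cauchy sequence of `E` converges to an element of `E`. -/
def IsQuasiComplete (E : Set S01) (N : S01 → ℝ) : Prop :=
  ∀ u : ℕ → S01, (∀ n, u n ∈ E) →
    (∀ ε : ℝ, 0 < ε → ∃ n₀ : ℕ, ∀ m ≥ n₀, ∀ n ≥ n₀, N (u m - u n) < ε) →
    ∃ x ∈ E, Tendsto (fun n => N (u n - x)) atTop (𝓝 0)

/-- A symmetric quasi-Banach function space on `(0,1)`. -/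
structure IsSymmetricQuasiBanach (E : Set S01) (N : S01 → ℝ) : Prop where
  quasiNormed : IsQuasiNormed E N
  complete : IsQuasiComplete E N
  solid : ∀ x ∈ E, ∀ y : S01, |y| ≤ |x| → y ∈ E ∧ N y ≤ N x
  symmetric : ∀ x ∈ E, ∀ y : S01, (∀ t ∈ Ioo (0 : ℝ) 1, rearr y t = rearr x t) →
    y ∈ E ∧ N y = N x

/-- The formula `(S f)(t) = (1/t) ∫₀ᵗ f(s) ds + ∫ₜ¹ f(s)/s ds`, for `0 < t < 1`. -/
def calderonFun (f : ℝ → ℝ) (t : ℝ) : ℝ :=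
  (1 / t) * (∫ s in (0 : ℝ)..t, f s) + ∫ s in t..(1 : ℝ), f s / s

lemma stronglyMeasurable_setIntegral_Ioc {f a b : ℝ → ℝ} (hf : StronglyMeasurable f)
    (ha : Measurable a) (hb : Measurable b) :
    StronglyMeasurable (fun t : ℝ => ∫ s in Ioc (a t) (b t), f s) := by
  have hs : MeasurableSet {p : ℝ × ℝ | p.2 ∈ Ioc (a p.1) (b p.1)} :=
    (measurableSet_lt (ha.comp measurable_fst) measurable_snd).inter
      (measurableSet_le measurable_snd (hb.comp measurable_fst))
  have h1 : StronglyMeasurable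
      ({p : ℝ × ℝ | p.2 ∈ Ioc (a p.1) (b p.1)}.indicator (fun p => f p.2)) :=
    (hf.comp_measurable measurable_snd).indicator hs
  have h2 := h1.integral_prod_right' (ν := (volume : Measure ℝ))
  convert h2 using 1
  funext t
  rw [← integral_indicator measurableSet_Ioc]
  rfl

lemma stronglyMeasurable_calderonFun {f : ℝ → ℝ} (hf : StronglyMeasurable f) :
    StronglyMeasurable (calderonFun f) := by
  have hg : StronglyMeasurable (fun s : ℝ => f s / s) :=
    (hf.measurable.div measurable_id).stronglyMeasurable
  have hinv : StronglyMeasurable (fun t : ℝ => 1 / t) :=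
    (measurable_const.div measurable_id).stronglyMeasurable
  unfold calderonFun
  simp only [intervalIntegral]
  exact (hinv.mul
    ((stronglyMeasurable_setIntegral_Ioc hf measurable_const measurable_id).sub
      (stronglyMeasurable_setIntegral_Ioc hf measurable_id measurable_const))).add
    ((stronglyMeasurable_setIntegral_Ioc hg measurable_id measurable_const).sub
      (stronglyMeasurable_setIntegral_Ioc hg measurable_const measurable_id))

/-- The Calderón operator `S`, meaningful on `L₁(0,1)`. -/
def calderon (x : S01) : S01 :=
  AEEqFun.mk (calderonFun x)
    (stronglyMeasurable_calderonFun x.stronglyMeasurable).aestronglyMeasurable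

/-- `E ⊂ L₁(0,1)`. -/
def SubsetL1 (E : Set S01) : Prop := ∀ x ∈ E, AEEqFun.Integrable x

/-- The space `L_{1,∞}(0,1)`: those `x` for which `sup_{0 < t ≤ 1} t μ(t; x)` is finite. -/
def weakL1 : Set S01 := {x | BddAbove ((fun t : ℝ => t * rearr x t) '' Ioc (0 : ℝ) 1)}

/-- The relation `μ(x) ≤ S μ(y)` on `(0,1)`. -/
def Dominated (x y : S01) : Prop :=
  ∀ t ∈ Ioo (0 : ℝ) 1, rearr x t ≤ calderonFun (rearr y) t

/-- The set `𝓢_E = {x ∈ L_{1,∞} : ∃ y ∈ E, μ(x) ≤ S μ(y)}`. -/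
def rangeSpace (E : Set S01) : Set S01 := {x | x ∈ weakL1 ∧ ∃ y ∈ E, Dominated x y}

/-- The functional `‖x‖_{𝓢_E} = inf {‖y‖_E : y ∈ E, μ(x) ≤ S μ(y)}`. -/
def rangeNorm (E : Set S01) (N : S01 → ℝ) (x : S01) : ℝ :=
  sInf {r : ℝ | ∃ y ∈ E, Dominated x y ∧ r = N y}

/-- The Calderón operator maps `(E, N)` boundedly into `(F, M)`. -/
def CalderonBounded (E : Set S01) (N : S01 → ℝ) (F : Set S01) (M : S01 → ℝ) : Prop :=
  ∃ C : ℝ, ∀ x ∈ E, calderon x ∈ F ∧ M (calderon x) ≤ C * N x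

/-- `G ⊂ F` with a continuous embedding. -/
def ContinuouslyEmbedded (G : Set S01) (L : S01 → ℝ) (F : Set S01) (M : S01 → ℝ) : Prop :=
  ∃ C : ℝ, ∀ x ∈ G, x ∈ F ∧ M x ≤ C * L x

/-- `(G, L)` is the optimal symmetric quasi-Banach range of the Calderón operator on `(E, N)`:
the least symmetric quasi-Banach function space into which `S` maps `E` boundedly. -/
structure IsOptimalRange (E : Set S01) (N : S01 → ℝ) (G : Set S01) (L : S01 → ℝ) : Prop where
  symmetricQuasiBanach : IsSymmetricQuasiBanach G L
  bounded : CalderonBounded E N G L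
  least : ∀ (F : Set S01) (M : S01 → ℝ), IsSymmetricQuasiBanach F M →
    CalderonBounded E N F M → ContinuouslyEmbedded G L F M

end CalderonRange

end

noncomputable section

namespace CalderonRange

/-! ### The decreasing rearrangement -/

/-! On integrable f the operator is integration against the kernel 1/max(t,s), so for f ≥ 0 the
function Sf is decreasing, satisfies Sf(t/2) ≤ 2 Sf(t), and t·Sf(t) ≤ ‖f‖₁. By the Hardy–Littlewood
inequality Sf ≤ Sμ(f), so μ(x) ≤ Sμ(y) may be replaced by μ(x) ≤ Sf with 0 ≤ f ∈ E (`Majorized`), a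
condition in which f enters linearly.

Since μ(t; x₁+x₂) ≤ μ(t/2; x₁) + μ(t/2; x₂), majorants add up to a factor 2 (`Majorized.add`), which
gives the quasi-triangle inequality. Definiteness comes from the automatic continuity of E ⊂ L₁
(`exists_integral_abs_le`). For completeness, a fast Cauchy subsequence has increments majorized by
f_j of norm at most (4K)⁻ʲ, where K is the quasi-triangle constant of E. Summing costs weights
2^(j+1), and the weighted series still converges in E. Meanwhile the subsequence converges a.e. by
Borel–Cantelli, and μ passes to the limit by a Fatou argument.

Optimality: if S maps E into F and μ(x) ≤ Sμ(y), then μ(x) ∈ F by solidity and x ∈ F by symmetry,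
with the norm bound of S. -/

instance : IsProbabilityMeasure leb := ⟨by simp [leb]⟩

lemma measurableSet_superlevel (x : S01) (s : ℝ) : MeasurableSet {u : ℝ | s < |x u|} :=
  measurableSet_lt measurable_const x.stronglyMeasurable.measurable.abs

/-- Right-continuity of the distribution function, by continuity of measure from below. -/
lemma superlevel_union (x : S01) {s : ℝ} {d : ENNReal}
    (h : ∀ r > s, leb {u : ℝ | r < |x u|} ≤ d) : leb {u : ℝ | s < |x u|} ≤ d := by
  have hU : {u : ℝ | s < |x u|} = ⋃ n : ℕ, {u : ℝ | s + 1 / ((n : ℝ) + 1) < |x u|} := by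
    ext u
    simp only [mem_ofPred_eq, mem_iUnion]
    constructor
    · intro hu
      obtain ⟨n, hn⟩ := exists_nat_one_div_lt (sub_pos.2 hu)
      exact ⟨n, by linarith⟩
    · rintro ⟨n, hn⟩
      have : (0 : ℝ) < 1 / ((n : ℝ) + 1) := by positivity
      linarith
  have hm : Monotone fun n : ℕ => {u : ℝ | s + 1 / ((n : ℝ) + 1) < |x u|} := by
    intro m n hmn u hu
    have : 1 / ((n : ℝ) + 1) ≤ 1 / ((m : ℝ) + 1) := by gcongr
    simp only [mem_ofPred_eq] at hu ⊢
    linarith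
  rw [hU, hm.measure_iUnion]
  exact iSup_le fun n => h _ (by have : (0 : ℝ) < 1 / ((n : ℝ) + 1) := by positivity
                                 linarith)

lemma exists_superlevel_le (x : S01) {t : ℝ} (ht : 0 < t) :
    ∃ s : ℝ, 0 ≤ s ∧ leb {u : ℝ | s < |x u|} ≤ ENNReal.ofReal t := by
  have hI : ⋂ n : ℕ, {u : ℝ | (n : ℝ) < |x u|} = ∅ := by
    ext u
    simp only [mem_iInter, mem_ofPred_eq, mem_empty_iff_false, iff_false, not_forall, not_lt]
    exact exists_nat_ge _
  have ha : Antitone fun n : ℕ => {u : ℝ | (n : ℝ) < |x u|} := by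
    intro m n hmn u hu
    exact lt_of_le_of_lt (Nat.cast_le.2 hmn : (m : ℝ) ≤ n) hu
  have hT := tendsto_measure_iInter_atTop (μ := leb)
    (fun n : ℕ => (measurableSet_superlevel x n).nullMeasurableSet) ha ⟨0, measure_ne_top _ _⟩
  rw [hI, measure_empty] at hT
  obtain ⟨n, hn⟩ := (hT.eventually_lt_const (ENNReal.ofReal_pos.2 ht)).exists
  exact ⟨n, Nat.cast_nonneg n, hn.le⟩

lemma rearr_nonneg (x : S01) (t : ℝ) : 0 ≤ rearr x t := Real.sInf_nonneg fun _ h => h.1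

lemma bddBelow_levels (x : S01) (t : ℝ) :
    BddBelow {s : ℝ | 0 ≤ s ∧ leb {u : ℝ | s < |x u|} ≤ ENNReal.ofReal t} :=
  ⟨0, fun _ h => h.1⟩

/-- The infimum is attained by right-continuity, so bounds on μ become bounds on the distribution
function. At t = 0 this fails for unbounded x, where the set of levels is empty and `sInf` returns
0. -/
lemma rearr_le_iff (x : S01) {t s : ℝ} (ht : 0 < t) (hs : 0 ≤ s) :
    rearr x t ≤ s ↔ leb {u : ℝ | s < |x u|} ≤ ENNReal.ofReal t := by
  constructor
  · intro h
    refine superlevel_union x fun r hr => ?_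
    obtain ⟨a, ha, har⟩ := exists_lt_of_csInf_lt (exists_superlevel_le x ht) (h.trans_lt hr)
    exact (measure_mono fun u (hu : r < |x u|) => har.trans hu).trans ha.2
  · intro h
    exact csInf_le (bddBelow_levels x t) ⟨hs, h⟩

lemma lt_rearr_iff (x : S01) {t s : ℝ} (ht : 0 < t) (hs : 0 ≤ s) :
    s < rearr x t ↔ ENNReal.ofReal t < leb {u : ℝ | s < |x u|} := by
  rw [← not_le, rearr_le_iff x ht hs, not_le]

lemma superlevel_rearr_le (x : S01) {t : ℝ} (ht : 0 < t) :
    leb {u : ℝ | rearr x t < |x u|} ≤ ENNReal.ofReal t :=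
  (rearr_le_iff x ht (rearr_nonneg x t)).1 le_rfl

lemma rearr_antitoneOn (x : S01) : AntitoneOn (rearr x) (Ioi 0) := fun a ha _ hb hab =>
  (rearr_le_iff x hb (rearr_nonneg x a)).2
    ((superlevel_rearr_le x ha).trans (ENNReal.ofReal_le_ofReal hab))

lemma rearr_le_rearr {x y : S01} {t : ℝ} (ht : 0 < t)
    (h : ∀ s, 0 ≤ s → leb {u : ℝ | s < |x u|} ≤ leb {u : ℝ | s < |y u|}) :
    rearr x t ≤ rearr y t :=
  (rearr_le_iff x ht (rearr_nonneg y t)).2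
    ((h _ (rearr_nonneg y t)).trans (superlevel_rearr_le y ht))

lemma rearr_eq_of_superlevel_eq {x y : S01}
    (h : ∀ s, 0 ≤ s → leb {u : ℝ | s < |x u|} = leb {u : ℝ | s < |y u|}) (t : ℝ) :
    rearr x t = rearr y t := by
  unfold rearr
  congr 1
  ext s
  simp only [mem_ofPred_eq]
  exact and_congr_right fun hs => by rw [h s hs]

lemma abs_le_abs_iff_ae {x y : S01} : |y| ≤ |x| ↔ ∀ᵐ u ∂leb, |y u| ≤ |x u| := by
  rw [← AEEqFun.coeFn_le]
  constructor <;> intro h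
  · filter_upwards [h, AEEqFun.coeFn_abs x, AEEqFun.coeFn_abs y] with u h1 h2 h3
    rwa [h2, h3] at h1
  · filter_upwards [h, AEEqFun.coeFn_abs x, AEEqFun.coeFn_abs y] with u h1 h2 h3
    rwa [h2, h3]

lemma rearr_le_rearr_of_abs_le {x y : S01} (h : |y| ≤ |x|) {t : ℝ} (ht : 0 < t) :
    rearr y t ≤ rearr x t := by
  refine rearr_le_rearr ht fun s _ => measure_mono_ae ?_
  filter_upwards [abs_le_abs_iff_ae.1 h] with u hu (hs : s < |y u|)
  exact hs.trans_le hu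

lemma rearr_zero (t : ℝ) : rearr 0 t = 0 := by
  refine le_antisymm (csInf_le (bddBelow_levels 0 t) ⟨le_rfl, ?_⟩) (rearr_nonneg 0 t)
  refine le_of_eq_of_le ?_ (zero_le : (0 : ENNReal) ≤ _)
  have h : ∀ᵐ u ∂leb, (0 : S01) u = 0 := AEEqFun.coeFn_zero
  have : ∀ᵐ u ∂leb, ¬ (0 < |(0 : S01) u|) := by
    filter_upwards [h] with u hu
    simp [hu]
  exact measure_eq_zero_iff_ae_notMem.2 this

lemma rearr_smul (c : ℝ) (x : S01) {t : ℝ} (ht : 0 < t) :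
    rearr (c • x) t ≤ |c| * rearr x t := by
  refine (rearr_le_iff _ ht (mul_nonneg (abs_nonneg c) (rearr_nonneg x t))).2 ?_
  refine le_trans (measure_mono_ae ?_) (superlevel_rearr_le x ht)
  filter_upwards [AEEqFun.coeFn_smul c x] with u hu (hs : _ < |(c • x) u|)
  rw [hu, Pi.smul_apply, smul_eq_mul, abs_mul] at hs
  exact lt_of_mul_lt_mul_left hs (abs_nonneg c)

lemma rearr_add (x y : S01) {a b : ℝ} (ha : 0 < a) (hb : 0 < b) :
    rearr (x + y) (a + b) ≤ rearr x a + rearr y b := by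
  refine (rearr_le_iff _ (add_pos ha hb) (add_nonneg (rearr_nonneg x a) (rearr_nonneg y b))).2 ?_
  rw [ENNReal.ofReal_add ha.le hb.le]
  refine le_trans ?_ (add_le_add (superlevel_rearr_le x ha) (superlevel_rearr_le y hb))
  refine le_trans (measure_mono_ae ?_) (measure_union_le _ _)
  filter_upwards [AEEqFun.coeFn_add x y] with u hu (hs : _ < |(x + y) u|)
  rw [hu, Pi.add_apply] at hs
  by_contra hn
  have h1 : ¬ (rearr x a < |x u|) := fun h => hn (Or.inl h)
  have h2 : ¬ (rearr y b < |y u|) := fun h => hn (Or.inr h)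
  linarith [abs_add_le (x u) (y u)]

lemma eq_zero_of_rearr_eq_zero {x : S01} (h : ∀ t ∈ Ioo (0 : ℝ) 1, rearr x t = 0) : x = 0 := by
  have h0 : leb {u : ℝ | 0 < |x u|} = 0 := by
    refine le_antisymm (ENNReal.le_of_forall_pos_le_add fun ε hε _ => ?_) zero_le
    rw [zero_add]
    have hm : (0 : ℝ) < min ε (1 / 2) := lt_min (by exact_mod_cast hε) (by norm_num)
    refine ((rearr_le_iff x hm le_rfl).1
      (h _ ⟨hm, (min_le_right _ _).trans_lt (by norm_num)⟩).le).trans ?_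
    exact (ENNReal.ofReal_le_ofReal (min_le_left _ _)).trans (by simp)
  refine AEEqFun.ext ?_
  have h1 := measure_eq_zero_iff_ae_notMem.1 h0
  filter_upwards [h1, AEEqFun.coeFn_zero (β := ℝ) (μ := leb)] with u hu hz
  rw [hz]
  simpa using hu

/-- Fatou property: almost every point where the limit exceeds a lies in all but finitely many of
the sets where `v n` does. -/
lemma rearr_le_of_tendsto_ae {v : ℕ → S01} {x : S01} {t a : ℝ} (ht : 0 < t)
    (hlim : ∀ᵐ u ∂leb, Tendsto (fun n => v n u) atTop (𝓝 (x u)))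
    (h : ∀ n, rearr (v n) t ≤ a) : rearr x t ≤ a := by
  have ha : 0 ≤ a := (rearr_nonneg _ _).trans (h 0)
  refine (rearr_le_iff x ht ha).2 ?_
  have hm : Monotone fun N : ℕ => ⋂ n ≥ N, {u : ℝ | a < |v n u|} := by
    intro M N hMN u hu
    simp only [mem_iInter] at hu ⊢
    exact fun n hn => hu n (hMN.trans hn)
  calc leb {u : ℝ | a < |x u|} ≤ leb (⋃ N : ℕ, ⋂ n ≥ N, {u : ℝ | a < |v n u|}) := by
        refine measure_mono_ae ?_
        filter_upwards [hlim] with u hu (hs : a < |x u|)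
        obtain ⟨N, hN⟩ := eventually_atTop.1 (hu.abs.eventually_const_lt hs)
        exact mem_iUnion.2 ⟨N, mem_iInter₂.2 fun n hn => hN n hn⟩
    _ ≤ ENNReal.ofReal t := by
        rw [hm.measure_iUnion]
        refine iSup_le fun N => (measure_mono (iInter₂_subset N le_rfl)).trans ?_
        exact (rearr_le_iff (v N) ht ha).1 (h N)

lemma aestronglyMeasurable_of_antitoneOn {f : ℝ → ℝ} (hf : AntitoneOn f (Ioo 0 1)) :
    AEStronglyMeasurable f leb :=
  (aemeasurable_restrict_of_antitoneOn measurableSet_Ioo hf).aestronglyMeasurable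

lemma aestronglyMeasurable_rearr (x : S01) : AEStronglyMeasurable (rearr x) leb :=
  aestronglyMeasurable_of_antitoneOn ((rearr_antitoneOn x).mono Ioo_subset_Ioi_self)

/-- The class of the decreasing rearrangement of `x`. -/
def rearrClass (x : S01) : S01 := AEEqFun.mk (rearr x) (aestronglyMeasurable_rearr x)

lemma coeFn_rearrClass (x : S01) : rearrClass x =ᵐ[leb] rearr x := AEEqFun.coeFn_mk _ _

lemma ae_leb_mem : ∀ᵐ u ∂leb, u ∈ Ioo (0 : ℝ) 1 := ae_restrict_mem measurableSet_Ioo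

lemma leb_Ioo_zero {d : ℝ} (hd : d ≤ 1) : leb (Ioo 0 d) = ENNReal.ofReal d := by
  rw [Measure.restrict_apply measurableSet_Ioo, Ioo_inter_Ioo]
  simp [hd]

lemma superlevel_rearr_ae_eq (x : S01) {s : ℝ} (hs : 0 ≤ s) :
    {u : ℝ | s < rearr x u} =ᵐ[leb] Ioo 0 (leb {u : ℝ | s < |x u|}).toReal := by
  filter_upwards [ae_leb_mem] with u hu
  refine propext ?_
  change s < rearr x u ↔ u ∈ Ioo 0 (leb {u : ℝ | s < |x u|}).toReal
  rw [lt_rearr_iff x hu.1 hs, ENNReal.ofReal_lt_iff_lt_toReal hu.1.le (measure_ne_top _ _)]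
  simp [hu.1]

lemma superlevel_rearrClass (x : S01) {s : ℝ} (hs : 0 ≤ s) :
    leb {u : ℝ | s < |rearrClass x u|} = leb {u : ℝ | s < |x u|} := by
  have h1 : {u : ℝ | s < |rearrClass x u|} =ᵐ[leb] {u : ℝ | s < rearr x u} := by
    filter_upwards [coeFn_rearrClass x] with u hu
    refine propext ?_
    change s < |rearrClass x u| ↔ s < rearr x u
    rw [hu, abs_of_nonneg (rearr_nonneg x u)]
  rw [measure_congr h1, measure_congr (superlevel_rearr_ae_eq x hs), leb_Ioo_zero,
    ENNReal.ofReal_toReal (measure_ne_top _ _)]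
  exact ENNReal.toReal_le_of_le_ofReal zero_le_one (by rw [ENNReal.ofReal_one]; exact prob_le_one)

lemma rearr_rearrClass (x : S01) (t : ℝ) : rearr (rearrClass x) t = rearr x t :=
  rearr_eq_of_superlevel_eq (fun _ hs => superlevel_rearrClass x hs) t

lemma rearr_le_of_abs_le_antitoneOn {x : S01} {f : ℝ → ℝ} (hf : AntitoneOn f (Ioo 0 1))
    (hx : ∀ᵐ u ∂leb, |x u| ≤ f u) {t : ℝ} (ht : t ∈ Ioo (0 : ℝ) 1) (h0 : 0 ≤ f t) :
    rearr x t ≤ f t := by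
  refine (rearr_le_iff x ht.1 h0).2 ?_
  rw [← leb_Ioo_zero ht.2.le]
  refine measure_mono_ae ?_
  filter_upwards [hx, ae_leb_mem] with u hu hu1 (hs : f t < |x u|)
  refine ⟨hu1.1, ?_⟩
  by_contra hn
  exact absurd (hf ht hu1 (not_lt.1 hn)) (not_le.2 (hs.trans_le hu))

/-! ### The Hardy–Littlewood inequality -/

/-- Bathtub principle: with B = (0, d) of the same measure as A, the sets A \ B and B \ A have equal
measure, and k is at most k(d) on the first and at least k(d) on the second. -/
lemma setLIntegral_le_setLIntegral_Ioo {k : ℝ → ENNReal} (hk : AntitoneOn k (Ioo 0 1))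
    {A : Set ℝ} (hA : MeasurableSet A) :
    ∫⁻ u in A, k u ∂leb ≤ ∫⁻ u in Ioo 0 (leb A).toReal, k u ∂leb := by
  set d := (leb A).toReal with hd
  have hAd : leb A = ENNReal.ofReal d := (ENNReal.ofReal_toReal (measure_ne_top _ _)).symm
  rcases le_or_gt 1 d with h1 | h1
  · refine lintegral_mono_set' ?_
    filter_upwards [ae_leb_mem] with u hu _
    exact ⟨hu.1, hu.2.trans_le h1⟩
  rcases (ENNReal.toReal_nonneg : 0 ≤ d).eq_or_lt with h0 | h0
  · rw [show d = 0 from h0.symm, ENNReal.ofReal_zero] at hAd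
    rw [setLIntegral_measure_zero _ _ hAd]
    exact zero_le
  set B := Ioo 0 d with hB
  have hmB : MeasurableSet B := measurableSet_Ioo
  have hdiff : leb (A \ B) = leb (B \ A) := by
    have h := (measure_sdiff_add_inter (μ := leb) A hmB).trans
      (hAd.trans (leb_Ioo_zero h1.le).symm)
    rw [← measure_sdiff_add_inter (μ := leb) B hA, inter_comm B A] at h
    exact (ENNReal.add_left_inj (measure_ne_top _ _)).1 h
  have hdm : d ∈ Ioo (0 : ℝ) 1 := ⟨h0, h1⟩
  rw [← lintegral_inter_add_sdiff k A hmB, ← lintegral_inter_add_sdiff k B hA, inter_comm B A]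
  refine add_le_add le_rfl ?_
  calc ∫⁻ u in A \ B, k u ∂leb ≤ ∫⁻ _ in A \ B, k d ∂leb := by
        refine setLIntegral_mono_ae' (hA.diff hmB) ?_
        filter_upwards [ae_leb_mem] with u hu hAB
        exact hk hdm hu (not_lt.1 fun h => hAB.2 ⟨hu.1, h⟩)
    _ = ∫⁻ _ in B \ A, k d ∂leb := by rw [setLIntegral_const, setLIntegral_const, hdiff]
    _ ≤ ∫⁻ u in B \ A, k u ∂leb := by
        refine setLIntegral_mono_ae' (hmB.diff hA) ?_
        filter_upwards [ae_leb_mem] with u hu hBA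
        exact hk hu hdm hBA.1.2.le

/-- Layer-cake formula for the measure with density k: the superlevel sets of the rearrangement are
initial intervals, so the bathtub principle applies at each height. -/
lemma lintegral_mul_le_lintegral_rearr_mul (x : S01) {k : ℝ → ENNReal} (hkm : Measurable k)
    (hk : AntitoneOn k (Ioo 0 1)) :
    ∫⁻ u, k u * ENNReal.ofReal |x u| ∂leb ≤ ∫⁻ u, k u * ENNReal.ofReal (rearr x u) ∂leb := by
  set ν := leb.withDensity k with hν
  have hac : ν ≪ leb := withDensity_absolutelyContinuous _ _
  have hx : AEMeasurable (fun u => |x u|) leb := x.stronglyMeasurable.measurable.abs.aemeasurable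
  have hr : AEMeasurable (rearr x) leb := (aestronglyMeasurable_rearr x).aemeasurable
  have e1 := lintegral_withDensity_eq_lintegral_mul₀ hkm.aemeasurable hx.ennreal_ofReal
  have e2 := lintegral_withDensity_eq_lintegral_mul₀ hkm.aemeasurable hr.ennreal_ofReal
  simp only [Pi.mul_apply] at e1 e2
  rw [← e1, ← e2, lintegral_eq_lintegral_meas_lt _ (ae_of_all _ fun u => abs_nonneg _)
    (hx.mono_ac hac), lintegral_eq_lintegral_meas_lt _ (ae_of_all _ fun u => rearr_nonneg x u)
    (hr.mono_ac hac)]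
  refine setLIntegral_mono' measurableSet_Ioi fun s (hs : 0 < s) => ?_
  rw [withDensity_apply' _ _, withDensity_apply' _ _,
    setLIntegral_congr (superlevel_rearr_ae_eq x hs.le)]
  exact setLIntegral_le_setLIntegral_Ioo hk (measurableSet_superlevel x s)

/-! ### The Calderón operator on functions -/

lemma integrable_mul_kernel {f : ℝ → ℝ} (hf : Integrable f leb) {t : ℝ} (ht : 0 < t) :
    Integrable (fun s => f s * (max t s)⁻¹) leb := by
  refine hf.mul_bdd (c := t⁻¹) (by fun_prop) (ae_of_all _ fun s => ?_)
  have : 0 < max t s := lt_max_of_lt_left ht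
  rw [Real.norm_of_nonneg (by positivity)]
  gcongr
  exact le_max_left _ _

/-- A single kernel, decreasing in each variable, replaces the two integrals; the estimates below
are read off from it. -/
lemma calderonFun_eq_integral {f : ℝ → ℝ} (hf : Integrable f leb) {t : ℝ}
    (ht : t ∈ Ioo (0 : ℝ) 1) : calderonFun f t = ∫ s, f s * (max t s)⁻¹ ∂leb := by
  have hi : IntervalIntegrable (fun s => f s * (max t s)⁻¹) volume 0 1 := by
    rw [intervalIntegrable_iff_integrableOn_Ioo_of_le zero_le_one]
    exact integrable_mul_kernel hf ht.1
  have e : ∫ s, f s * (max t s)⁻¹ ∂leb = ∫ s in (0 : ℝ)..1, f s * (max t s)⁻¹ := by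
    rw [intervalIntegral.integral_of_le zero_le_one, integral_Ioc_eq_integral_Ioo]
  have htm : t ∈ uIcc (0 : ℝ) 1 := by
    rw [uIcc_of_le zero_le_one]
    exact Ioo_subset_Icc_self ht
  rw [e, ← intervalIntegral.integral_add_adjacent_intervals
    (hi.mono_set (uIcc_subset_uIcc_left htm)) (hi.mono_set (uIcc_subset_uIcc_right htm))]
  unfold calderonFun
  congr 1
  · rw [← intervalIntegral.integral_const_mul]
    refine intervalIntegral.integral_congr fun s hs => ?_
    rw [uIcc_of_le ht.1.le] at hs
    simp only [max_eq_left hs.2]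
    ring
  · refine intervalIntegral.integral_congr fun s hs => ?_
    rw [uIcc_of_le ht.2.le] at hs
    simp only [max_eq_right hs.1]
    ring

lemma calderonFun_mono {f g : ℝ → ℝ} (hf : Integrable f leb) (hg : Integrable g leb)
    (h : f ≤ᵐ[leb] g) {t : ℝ} (ht : t ∈ Ioo (0 : ℝ) 1) : calderonFun f t ≤ calderonFun g t := by
  rw [calderonFun_eq_integral hf ht, calderonFun_eq_integral hg ht]
  refine integral_mono_ae (integrable_mul_kernel hf ht.1) (integrable_mul_kernel hg ht.1) ?_
  filter_upwards [h] with s hs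
  have : 0 < max t s := lt_max_of_lt_left ht.1
  gcongr

lemma calderonFun_congr {f g : ℝ → ℝ} (hf : Integrable f leb) (h : f =ᵐ[leb] g) {t : ℝ}
    (ht : t ∈ Ioo (0 : ℝ) 1) : calderonFun f t = calderonFun g t :=
  le_antisymm (calderonFun_mono hf (hf.congr h) h.le ht)
    (calderonFun_mono (hf.congr h) hf h.symm.le ht)

lemma calderonFun_add {f g : ℝ → ℝ} (hf : Integrable f leb) (hg : Integrable g leb)
    {t : ℝ} (ht : t ∈ Ioo (0 : ℝ) 1) :
    calderonFun (f + g) t = calderonFun f t + calderonFun g t := by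
  rw [calderonFun_eq_integral hf ht, calderonFun_eq_integral hg ht,
    calderonFun_eq_integral (hf.add hg) ht,
    ← integral_add (integrable_mul_kernel hf ht.1) (integrable_mul_kernel hg ht.1)]
  simp only [Pi.add_apply, add_mul]

lemma calderonFun_smul (c : ℝ) {f : ℝ → ℝ} (hf : Integrable f leb) {t : ℝ}
    (ht : t ∈ Ioo (0 : ℝ) 1) : calderonFun (c • f) t = c * calderonFun f t := by
  rw [calderonFun_eq_integral hf ht, calderonFun_eq_integral (hf.smul c) ht,
    ← integral_const_mul]
  simp only [Pi.smul_apply, smul_eq_mul, mul_assoc]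

lemma abs_calderonFun_le {f : ℝ → ℝ} (hf : Integrable f leb) {t : ℝ}
    (ht : t ∈ Ioo (0 : ℝ) 1) : |calderonFun f t| ≤ calderonFun (fun s => |f s|) t := by
  rw [calderonFun_eq_integral hf ht, calderonFun_eq_integral hf.abs ht]
  refine abs_integral_le_integral_abs.trans_eq (integral_congr_ae (ae_of_all _ fun s => ?_))
  have : 0 < max t s := lt_max_of_lt_left ht.1
  simp only [abs_mul, abs_of_pos (inv_pos.2 this)]

lemma calderonFun_antitoneOn {f : ℝ → ℝ} (hf : Integrable f leb) (h0 : 0 ≤ᵐ[leb] f) :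
    AntitoneOn (calderonFun f) (Ioo 0 1) := by
  intro a ha b hb hab
  rw [calderonFun_eq_integral hf ha, calderonFun_eq_integral hf hb]
  refine integral_mono_ae (integrable_mul_kernel hf hb.1) (integrable_mul_kernel hf ha.1) ?_
  filter_upwards [h0] with s (hs : 0 ≤ f s)
  have : 0 < max a s := lt_max_of_lt_left ha.1
  gcongr

lemma calderonFun_nonneg {f : ℝ → ℝ} (hf : Integrable f leb) (h0 : 0 ≤ᵐ[leb] f) {t : ℝ}
    (ht : t ∈ Ioo (0 : ℝ) 1) : 0 ≤ calderonFun f t := by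
  rw [calderonFun_eq_integral hf ht]
  refine integral_nonneg_of_ae ?_
  filter_upwards [h0] with s (hs : 0 ≤ f s)
  have : 0 < max t s := lt_max_of_lt_left ht.1
  change 0 ≤ f s * (max t s)⁻¹
  positivity

/-- Comes from max(t,s)/2 ≤ max(t/2,s); it absorbs the halving of the argument in `rearr_add`. -/
lemma calderonFun_half_le {f : ℝ → ℝ} (hf : Integrable f leb) (h0 : 0 ≤ᵐ[leb] f) {t : ℝ}
    (ht : t ∈ Ioo (0 : ℝ) 1) : calderonFun f (t / 2) ≤ 2 * calderonFun f t := by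
  have ht0 := ht.1
  have ht2 : t / 2 ∈ Ioo (0 : ℝ) 1 := ⟨by linarith [ht.1], by linarith [ht.1, ht.2]⟩
  rw [calderonFun_eq_integral hf ht, calderonFun_eq_integral hf ht2, ← integral_const_mul]
  refine integral_mono_ae (integrable_mul_kernel hf ht2.1)
    ((integrable_mul_kernel hf ht.1).const_mul 2) ?_
  filter_upwards [h0, ae_leb_mem] with s (hs : 0 ≤ f s) hs1
  have h1 : 0 < max t s := lt_max_of_lt_left ht.1
  have h2 : max t s / 2 ≤ max (t / 2) s := by
    rw [← max_div_div_right zero_le_two]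
    exact max_le_max le_rfl (by linarith [hs1.1])
  have h3 : (max (t / 2) s)⁻¹ ≤ 2 * (max t s)⁻¹ := by
    calc (max (t / 2) s)⁻¹ ≤ (max t s / 2)⁻¹ := by gcongr
      _ = 2 * (max t s)⁻¹ := by field_simp
  calc f s * (max (t / 2) s)⁻¹ ≤ f s * (2 * (max t s)⁻¹) := by gcongr
    _ = 2 * (f s * (max t s)⁻¹) := by ring

lemma mul_calderonFun_le {f : ℝ → ℝ} (hf : Integrable f leb) {t : ℝ}
    (ht : t ∈ Ioo (0 : ℝ) 1) : t * calderonFun f t ≤ ∫ s, |f s| ∂leb := by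
  rw [calderonFun_eq_integral hf ht, ← integral_const_mul]
  refine integral_mono ((integrable_mul_kernel hf ht.1).const_mul t) hf.abs fun s => ?_
  have h1 : 0 < max t s := lt_max_of_lt_left ht.1
  have h2 : t * (max t s)⁻¹ ≤ 1 := by
    rw [← div_eq_mul_inv, div_le_one h1]
    exact le_max_left _ _
  have h3 : 0 ≤ t * (max t s)⁻¹ := mul_nonneg ht.1.le (inv_nonneg.2 h1.le)
  calc t * (f s * (max t s)⁻¹) = (t * (max t s)⁻¹) * f s := by ring
    _ ≤ (t * (max t s)⁻¹) * |f s| := by gcongr; exact le_abs_self _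
    _ ≤ 1 * |f s| := by gcongr
    _ = |f s| := one_mul _

lemma calderonFun_le_calderonFun_rearr {x : S01} (hx : AEEqFun.Integrable x)
    (hr : Integrable (rearr x) leb) {t : ℝ} (ht : t ∈ Ioo (0 : ℝ) 1) :
    calderonFun x t ≤ calderonFun (rearr x) t := by
  refine (le_abs_self _).trans ((abs_calderonFun_le hx ht).trans ?_)
  have hk0 : ∀ s, 0 ≤ (max t s)⁻¹ := fun s => inv_nonneg.2 (ht.1.le.trans (le_max_left _ _))
  have hkm : Measurable fun s => ENNReal.ofReal (max t s)⁻¹ := by fun_prop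
  have hk : AntitoneOn (fun s => ENNReal.ofReal (max t s)⁻¹) (Ioo 0 1) := by
    intro a _ b _ hab
    have : 0 < max t a := lt_max_of_lt_left ht.1
    dsimp only
    gcongr
  have key := lintegral_mul_le_lintegral_rearr_mul x hkm hk
  simp only [← ENNReal.ofReal_mul (hk0 _)] at key
  rw [calderonFun_eq_integral hx.abs ht, calderonFun_eq_integral hr ht,
    integral_eq_lintegral_of_nonneg_ae (ae_of_all _ fun s => mul_nonneg (abs_nonneg _) (hk0 s))
      (integrable_mul_kernel hx.abs ht.1).aestronglyMeasurable,
    integral_eq_lintegral_of_nonneg_ae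
      (ae_of_all _ fun s => mul_nonneg (rearr_nonneg x s) (hk0 s))
      (integrable_mul_kernel hr ht.1).aestronglyMeasurable]
  refine ENNReal.toReal_mono ?_ ?_
  · exact (integrable_mul_kernel hr ht.1).lintegral_lt_top.ne
  · simpa only [mul_comm] using key

/-! ### Order structure and series in quasi-Banach function spaces -/

instance : IsOrderedAddMonoid S01 where
  add_le_add_left x y h z := by
    rw [← AEEqFun.coeFn_le] at h ⊢
    filter_upwards [h, AEEqFun.coeFn_add x z, AEEqFun.coeFn_add y z] with u h1 h2 h3
    rw [h2, h3]
    exact add_le_add_left h1 _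

lemma smul_nonneg_S01 {c : ℝ} (hc : 0 ≤ c) {x : S01} (hx : 0 ≤ x) : 0 ≤ c • x := by
  rw [← AEEqFun.coeFn_le] at hx ⊢
  filter_upwards [hx, AEEqFun.coeFn_smul c x, AEEqFun.coeFn_zero (β := ℝ) (μ := leb)]
    with u h1 h2 h3
  rw [h3] at h1 ⊢
  rw [h2]
  exact mul_nonneg hc h1

lemma ae_nonneg_of_nonneg {x : S01} (hx : 0 ≤ x) : 0 ≤ᵐ[leb] x := by
  rw [← AEEqFun.coeFn_le] at hx
  filter_upwards [hx, AEEqFun.coeFn_zero (β := ℝ) (μ := leb)] with u h1 h2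
  rwa [h2] at h1

lemma abs_abs_S01 (x : S01) : |(|x|)| = |x| := abs_of_nonneg (abs_nonneg x)

variable {E : Set S01} {N : S01 → ℝ}

lemma IsQuasiNormed.norm_neg (h : IsQuasiNormed E N) {x : S01} (hx : x ∈ E) : N (-x) = N x := by
  have := h.norm_smul (-1) x hx
  simpa using this

lemma IsQuasiNormed.neg_mem (h : IsQuasiNormed E N) {x : S01} (hx : x ∈ E) : -x ∈ E := by
  have := h.smul_mem (-1) x hx
  simpa using this

lemma IsQuasiNormed.sub_mem (h : IsQuasiNormed E N) {x y : S01} (hx : x ∈ E) (hy : y ∈ E) :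
    x - y ∈ E := by
  rw [sub_eq_add_neg]
  exact h.add_mem _ hx _ (h.neg_mem hy)

lemma IsQuasiNormed.norm_sub_comm (h : IsQuasiNormed E N) {x y : S01} (hx : x ∈ E) (hy : y ∈ E) :
    N (x - y) = N (y - x) := by
  rw [← h.norm_neg (h.sub_mem hx hy), neg_sub]

lemma IsQuasiNormed.norm_zero (h : IsQuasiNormed E N) : N 0 = 0 :=
  (h.eq_zero_iff 0 h.zero_mem).2 rfl

lemma IsQuasiNormed.exists_one_le (h : IsQuasiNormed E N) :
    ∃ K : ℝ, 1 ≤ K ∧ ∀ x ∈ E, ∀ y ∈ E, N (x + y) ≤ K * (N x + N y) := by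
  obtain ⟨K, hK⟩ := h.quasi_triangle
  refine ⟨max K 1, le_max_right _ _, fun x hx y hy => (hK x hx y hy).trans ?_⟩
  exact mul_le_mul_of_nonneg_right (le_max_left _ _) (add_nonneg (h.nonneg x hx) (h.nonneg y hy))

lemma IsQuasiNormed.sum_mem (h : IsQuasiNormed E N) {g : ℕ → S01} (hg : ∀ j, g j ∈ E) (m : ℕ) :
    ∑ j ∈ Finset.range m, g j ∈ E :=
  Finset.sum_induction g (· ∈ E) (fun a b ha hb => h.add_mem a ha b hb) h.zero_mem
    fun j _ => hg j

/-- Peeling off the first term leaves a tail of the same kind with A/(2K) for A, hence of norm at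
most A; one quasi-triangle inequality then gives K(A + A), uniformly in m. -/
lemma IsQuasiNormed.norm_sum_le (h : IsQuasiNormed E N) {K : ℝ} (hK : 1 ≤ K)
    (hKt : ∀ x ∈ E, ∀ y ∈ E, N (x + y) ≤ K * (N x + N y)) (m : ℕ) {g : ℕ → S01}
    (hg : ∀ j, g j ∈ E) {A : ℝ} (hA : 0 ≤ A) (hgA : ∀ j, N (g j) ≤ A * ((2 * K)⁻¹) ^ j) :
    N (∑ j ∈ Finset.range m, g j) ≤ 2 * K * A := by
  have hK0 : 0 < K := zero_lt_one.trans_le hK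
  induction m generalizing g A with
  | zero =>
    rw [Finset.sum_range_zero, h.norm_zero]
    positivity
  | succ m ih =>
    rw [Finset.sum_range_succ']
    refine (hKt _ (h.sum_mem (fun j => hg (j + 1)) m) _ (hg 0)).trans ?_
    have h1 := ih (g := fun j => g (j + 1)) (fun j => hg (j + 1)) (A := A * (2 * K)⁻¹)
      (by positivity) fun j => (hgA (j + 1)).trans_eq (by ring)
    have h2 : N (g 0) ≤ A := by simpa using hgA 0
    have h3 : 2 * K * (A * (2 * K)⁻¹) = A := by field_simp
    rw [h3] at h1
    nlinarith

lemma IsSymmetricQuasiBanach.abs_mem (hE : IsSymmetricQuasiBanach E N) {x : S01} (hx : x ∈ E) :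
    |x| ∈ E ∧ N |x| ≤ N x := hE.solid x hx _ (abs_abs_S01 x).le

lemma IsSymmetricQuasiBanach.rearrClass_mem (hE : IsSymmetricQuasiBanach E N) {x : S01}
    (hx : x ∈ E) : rearrClass x ∈ E ∧ N (rearrClass x) = N x :=
  hE.symmetric x hx _ fun t _ => rearr_rearrClass x t

/-- For m ≥ n, (s n − Y)⁺ ≤ |s m − Y|, so its norm vanishes as m grows. Continuity of `N`, which a
quasi-norm may lack, is not needed. -/
lemma IsSymmetricQuasiBanach.le_of_monotone_of_tendsto (hE : IsSymmetricQuasiBanach E N)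
    {s : ℕ → S01} (hs : ∀ n, s n ∈ E) (hmono : Monotone s) {Y : S01} (hY : Y ∈ E)
    (hlim : Tendsto (fun n => N (s n - Y)) atTop (𝓝 0)) (n : ℕ) : s n ≤ Y := by
  have hq := hE.quasiNormed
  have key : ∀ m ≥ n, (s n - Y)⁺ ∈ E ∧ N (s n - Y)⁺ ≤ N (s m - Y) := fun m hm => by
    refine hE.solid _ (hq.sub_mem (hs m) hY) _ ?_
    rw [abs_of_nonneg (posPart_nonneg _)]
    refine (posPart_mono (sub_le_sub_right (hmono hm) Y)).trans ?_
    exact sup_le (le_abs_self _) (abs_nonneg _)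
  have hmem := (key n le_rfl).1
  have h0 : N (s n - Y)⁺ ≤ 0 := ge_of_tendsto hlim (eventually_atTop.2 ⟨n, fun m hm => (key m hm).2⟩)
  have h1 := (hq.eq_zero_iff _ hmem).1 (le_antisymm h0 (hq.nonneg _ hmem))
  exact sub_nonpos.1 (posPart_eq_zero.1 h1)

lemma IsSymmetricQuasiBanach.exists_forall_sum_le (hE : IsSymmetricQuasiBanach E N) {K : ℝ}
    (hK : 1 ≤ K) (hKt : ∀ x ∈ E, ∀ y ∈ E, N (x + y) ≤ K * (N x + N y)) {g : ℕ → S01}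
    (hg : ∀ j, g j ∈ E) (hg0 : ∀ j, 0 ≤ g j) {A : ℝ} (hA : 0 ≤ A)
    (hgA : ∀ j, N (g j) ≤ A * ((2 * K)⁻¹) ^ j) :
    ∃ Y ∈ E, (∀ m, ∑ j ∈ Finset.range m, g j ≤ Y) ∧ N Y ≤ 2 * K ^ 2 * A := by
  have hq := hE.quasiNormed
  have hK0 : 0 < K := zero_lt_one.trans_le hK
  set s : ℕ → S01 := fun m => ∑ j ∈ Finset.range m, g j with hs
  have hsE : ∀ m, s m ∈ E := hq.sum_mem hg
  have htail : ∀ n m, n ≤ m → N (s m - s n) ≤ 2 * K * (A * ((2 * K)⁻¹) ^ n) := by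
    intro n m hnm
    obtain ⟨i, rfl⟩ := Nat.exists_eq_add_of_le hnm
    have e : s (n + i) - s n = ∑ j ∈ Finset.range i, g (n + j) := by
      simp only [hs, Finset.sum_range_add, add_sub_cancel_left]
    rw [e]
    exact hq.norm_sum_le hK hKt i (fun j => hg (n + j)) (by positivity)
      fun j => (hgA (n + j)).trans_eq (by ring)
  have hpow : Tendsto (fun n : ℕ => 2 * K * (A * ((2 * K)⁻¹) ^ n)) atTop (𝓝 0) := by
    have := (tendsto_pow_atTop_nhds_zero_of_lt_one (r := (2 * K)⁻¹) (by positivity)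
      (inv_lt_one_of_one_lt₀ (by linarith))).const_mul A |>.const_mul (2 * K)
    simpa using this
  obtain ⟨Y, hY, hlim⟩ := hE.complete s hsE fun ε hε => by
    obtain ⟨n₀, hn₀⟩ := eventually_atTop.1 (hpow.eventually_lt_const hε)
    refine ⟨n₀, fun m hm n hn => ?_⟩
    rcases le_total n m with h | h
    · exact (htail n m h).trans_lt (hn₀ n hn)
    · rw [hq.norm_sub_comm (hsE m) (hsE n)]
      exact (htail m n h).trans_lt (hn₀ m hm)
  refine ⟨Y, hY, hE.le_of_monotone_of_tendsto hsE ?_ hY hlim, ?_⟩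
  · refine monotone_nat_of_le_succ fun n => ?_
    simp only [hs, Finset.sum_range_succ]
    exact le_add_of_nonneg_right (hg0 n)
  · have h1 : ∀ n, N Y ≤ K * (N (s n - Y) + 2 * K * A) := fun n => by
      have h2 := hKt _ (hq.sub_mem hY (hsE n)) _ (hsE n)
      rw [sub_add_cancel, hq.norm_sub_comm hY (hsE n)] at h2
      refine h2.trans ?_
      gcongr
      exact hq.norm_sum_le hK hKt n hg hA hgA
    have h3 : Tendsto (fun n => K * (N (s n - Y) + 2 * K * A)) atTop (𝓝 (K * (0 + 2 * K * A))) :=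
      (hlim.add_const _).const_mul _
    exact (ge_of_tendsto' h3 h1).trans_eq (by ring)

lemma integral_sum_range {g : ℕ → S01} (hg : ∀ j, AEEqFun.Integrable (g j)) (m : ℕ) :
    AEEqFun.Integrable (∑ j ∈ Finset.range m, g j) ∧
      ∫ u, (∑ j ∈ Finset.range m, g j : S01) u ∂leb = ∑ j ∈ Finset.range m, ∫ u, g j u ∂leb := by
  induction m with
  | zero =>
    refine ⟨AEEqFun.integrable_zero, ?_⟩
    simp only [Finset.sum_range_zero]
    rw [integral_congr_ae AEEqFun.coeFn_zero]
    simp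
  | succ m ih =>
    simp only [Finset.sum_range_succ]
    refine ⟨ih.1.add (hg m), ?_⟩
    rw [integral_congr_ae (AEEqFun.coeFn_add _ _)]
    simp only [Pi.add_apply]
    rw [integral_add ih.1 (hg m), ih.2]

/-- Were there no bound, functions of integral 1 and norm at most (2K)⁻ⁿ would exist in E; their
partial sums lie below some Y ∈ E, whose integral would exceed every integer. -/
lemma IsSymmetricQuasiBanach.exists_integral_abs_le (hE : IsSymmetricQuasiBanach E N)
    (hE1 : SubsetL1 E) : ∃ C : ℝ, 0 ≤ C ∧ ∀ y ∈ E, ∫ u, |y u| ∂leb ≤ C * N y := by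
  have hq := hE.quasiNormed
  obtain ⟨K, hK, hKt⟩ := hq.exists_one_le
  have hK0 : 0 < K := zero_lt_one.trans_le hK
  by_contra! hcon
  choose y hyE hy using fun n : ℕ => hcon ((2 * K) ^ n) (by positivity)
  have hI : ∀ n, 0 < ∫ u, |y n u| ∂leb := fun n =>
    (mul_nonneg (by positivity) (hq.nonneg _ (hyE n))).trans_lt (hy n)
  set g : ℕ → S01 := fun n => (∫ u, |y n u| ∂leb)⁻¹ • |y n| with hgdef
  have hg : ∀ n, g n ∈ E := fun n => hq.smul_mem _ _ (hE.abs_mem (hyE n)).1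
  have hg0 : ∀ n, 0 ≤ g n := fun n => smul_nonneg_S01 (inv_nonneg.2 (hI n).le) (abs_nonneg _)
  have hgN : ∀ n, N (g n) ≤ 1 * ((2 * K)⁻¹) ^ n := fun n => by
    rw [hq.norm_smul _ _ (hE.abs_mem (hyE n)).1, abs_of_pos (inv_pos.2 (hI n)), one_mul, inv_pow,
      inv_mul_le_iff₀ (hI n), ← div_eq_mul_inv, le_div_iff₀ (by positivity), mul_comm]
    exact (mul_le_mul_of_nonneg_left (hE.abs_mem (hyE n)).2 (by positivity)).trans (hy n).le
  have hg1 : ∀ n, ∫ u, g n u ∂leb = 1 := fun n => by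
    have e : g n =ᵐ[leb] fun u => (∫ v, |y n v| ∂leb)⁻¹ * |y n u| := by
      filter_upwards [AEEqFun.coeFn_smul (∫ v, |y n v| ∂leb)⁻¹ |y n|, AEEqFun.coeFn_abs (y n)]
        with u h1 h2
      rw [h1, Pi.smul_apply, h2, smul_eq_mul]
    rw [integral_congr_ae e, integral_const_mul, inv_mul_cancel₀ (hI n).ne']
  obtain ⟨Y, hY, hYs, -⟩ := hE.exists_forall_sum_le hK hKt hg hg0 zero_le_one hgN
  obtain ⟨m, hm⟩ := exists_nat_gt (∫ u, Y u ∂leb)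
  have h1 := integral_sum_range (fun j => hE1 _ (hg j)) m
  have h2 : (m : ℝ) ≤ ∫ u, Y u ∂leb := by
    calc (m : ℝ) = ∫ u, (∑ j ∈ Finset.range m, g j : S01) u ∂leb := by simp [h1.2, hg1]
      _ ≤ ∫ u, Y u ∂leb := integral_mono_ae h1.1 (hE1 Y hY) (AEEqFun.coeFn_le.2 (hYs m))
  linarith

/-! ### Majorization by the Calderón operator -/

/-- The relation `μ(x) ≤ S f` on `(0,1)`. -/
def Majorized (x f : S01) : Prop := ∀ t ∈ Ioo (0 : ℝ) 1, rearr x t ≤ calderonFun f t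

lemma Majorized.mono {x f g : S01} (h : Majorized x f) (hf : AEEqFun.Integrable f)
    (hg : AEEqFun.Integrable g) (hfg : f ≤ g) : Majorized x g := fun t ht =>
  (h t ht).trans (calderonFun_mono hf hg (AEEqFun.coeFn_le.2 hfg) ht)

lemma Majorized.smul {x f : S01} (h : Majorized x f) (hf : AEEqFun.Integrable f) (c : ℝ) :
    Majorized (c • x) (|c| • f) := fun t ht => by
  rw [calderonFun_congr hf.smul (AEEqFun.coeFn_smul _ _) ht, calderonFun_smul _ hf ht]
  exact (rearr_smul c x ht.1).trans (mul_le_mul_of_nonneg_left (h t ht) (abs_nonneg c))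

lemma Majorized.add {x₁ x₂ f₁ f₂ : S01} (h₁ : Majorized x₁ f₁) (h₂ : Majorized x₂ f₂)
    (hf₁ : AEEqFun.Integrable f₁) (hf₂ : AEEqFun.Integrable f₂) (hp₁ : 0 ≤ f₁) (hp₂ : 0 ≤ f₂) :
    Majorized (x₁ + x₂) ((2 : ℝ) • (f₁ + f₂)) := fun t ht => by
  have ht2 : t / 2 ∈ Ioo (0 : ℝ) 1 := ⟨by linarith [ht.1], by linarith [ht.1, ht.2]⟩
  rw [calderonFun_congr (hf₁.add hf₂).smul (AEEqFun.coeFn_smul _ _) ht,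
    calderonFun_smul _ (hf₁.add hf₂) ht,
    calderonFun_congr (hf₁.add hf₂) (AEEqFun.coeFn_add _ _) ht, calderonFun_add hf₁ hf₂ ht]
  have h := rearr_add x₁ x₂ ht2.1 ht2.1
  rw [add_halves] at h
  linarith [h₁ _ ht2, h₂ _ ht2, calderonFun_half_le hf₁ (ae_nonneg_of_nonneg hp₁) ht,
    calderonFun_half_le hf₂ (ae_nonneg_of_nonneg hp₂) ht]

lemma majorized_zero : Majorized 0 0 := fun t ht => by
  rw [rearr_zero]
  exact calderonFun_nonneg AEEqFun.integrable_zero (ae_nonneg_of_nonneg le_rfl) ht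

/-- Detaching the first term before each use of `Majorized.add` makes the j-th term pay the factor 2
exactly j + 1 times, whatever m is. -/
lemma Majorized.sum (m : ℕ) {d f : ℕ → S01} (h : ∀ j, Majorized (d j) (f j))
    (hf : ∀ j, AEEqFun.Integrable (f j)) (hp : ∀ j, 0 ≤ f j) :
    Majorized (∑ j ∈ Finset.range m, d j)
      (∑ j ∈ Finset.range m, (2 : ℝ) ^ (j + 1) • f j) := by
  induction m generalizing d f with
  | zero => exact majorized_zero
  | succ m ih =>
    have h1 := (ih (fun j => h (j + 1)) (fun j => hf (j + 1)) fun j => hp (j + 1)).add (h 0)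
      (integral_sum_range (fun j => (hf (j + 1)).smul) m).1 (hf 0)
      (Finset.sum_nonneg fun j _ => smul_nonneg_S01 (by positivity) (hp (j + 1))) (hp 0)
    rw [Finset.sum_range_succ', Finset.sum_range_succ']
    convert h1 using 1
    rw [smul_add, Finset.smul_sum]
    congr 1
    · refine Finset.sum_congr rfl fun j _ => ?_
      rw [smul_smul, ← pow_succ']
    · simp

lemma Majorized.mul_rearr_le {x f : S01} (h : Majorized x f) (hf : AEEqFun.Integrable f)
    {t : ℝ} (ht : t ∈ Ioo (0 : ℝ) 1) : t * rearr x t ≤ ∫ u, |f u| ∂leb :=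
  (mul_le_mul_of_nonneg_left (h t ht) ht.1.le).trans (mul_calderonFun_le hf ht)

/-- Needed because `weakL1` includes t = 1, whereas majorization only concerns t < 1. -/
lemma rearr_one (x : S01) : rearr x 1 = 0 :=
  le_antisymm ((rearr_le_iff x one_pos le_rfl).2 (by rw [ENNReal.ofReal_one]; exact prob_le_one))
    (rearr_nonneg x 1)

lemma Majorized.mem_weakL1 {x f : S01} (h : Majorized x f) (hf : AEEqFun.Integrable f) :
    x ∈ weakL1 := by
  refine ⟨∫ u, |f u| ∂leb, ?_⟩
  rintro _ ⟨t, ht, rfl⟩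
  rcases ht.2.lt_or_eq with h1 | rfl
  · exact h.mul_rearr_le hf ⟨ht.1, h1⟩
  · simp only [rearr_one, mul_zero]
    exact integral_nonneg fun _ => abs_nonneg _

/-- |Sx| ≤ S|x|, and S|x| is already decreasing, so it bounds the rearrangement too. -/
lemma majorized_calderon {x : S01} (hx : AEEqFun.Integrable x) : Majorized (calderon x) |x| := by
  have hxa : AEEqFun.Integrable |x| := hx.abs.congr (AEEqFun.coeFn_abs x).symm
  have h0 := ae_nonneg_of_nonneg (abs_nonneg x)
  intro t ht
  refine rearr_le_of_abs_le_antitoneOn (calderonFun_antitoneOn hxa h0) ?_ ht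
    (calderonFun_nonneg hxa h0 ht)
  have e : calderon x =ᵐ[leb] calderonFun x := AEEqFun.coeFn_mk _ _
  filter_upwards [e, ae_leb_mem] with u hu hu1
  rw [hu, calderonFun_congr hxa (AEEqFun.coeFn_abs x) hu1]
  exact abs_calderonFun_le hx hu1

lemma integrable_rearr (hE : IsSymmetricQuasiBanach E N) (hE1 : SubsetL1 E) {y : S01}
    (hy : y ∈ E) : Integrable (rearr y) leb :=
  (hE1 _ (hE.rearrClass_mem hy).1).congr (coeFn_rearrClass y)

lemma Majorized.dominated (hE : IsSymmetricQuasiBanach E N) (hE1 : SubsetL1 E) {x y : S01}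
    (hy : y ∈ E) (h : Majorized x y) : Dominated x y := fun t ht =>
  (h t ht).trans (calderonFun_le_calderonFun_rearr (hE1 y hy) (integrable_rearr hE hE1 hy) ht)

lemma Dominated.majorized (hE : IsSymmetricQuasiBanach E N) (hE1 : SubsetL1 E) {x y : S01}
    (hy : y ∈ E) (h : Dominated x y) : Majorized x (rearrClass y) := fun t ht => by
  rw [calderonFun_congr (hE1 _ (hE.rearrClass_mem hy).1) (coeFn_rearrClass y) ht]
  exact h t ht

lemma rearrClass_nonneg (y : S01) : 0 ≤ rearrClass y := by
  rw [← AEEqFun.coeFn_le]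
  filter_upwards [coeFn_rearrClass y, AEEqFun.coeFn_zero (β := ℝ) (μ := leb)] with u h1 h2
  rw [h1, h2]
  exact rearr_nonneg y u

/-! ### The range space -/

lemma rangeNorm_le (hE : IsSymmetricQuasiBanach E N) (hE1 : SubsetL1 E) {x y : S01}
    (hy : y ∈ E) (h : Majorized x y) : x ∈ rangeSpace E ∧ rangeNorm E N x ≤ N y :=
  ⟨⟨h.mem_weakL1 (hE1 y hy), y, hy, h.dominated hE hE1 hy⟩,
    csInf_le ⟨0, by rintro _ ⟨z, hz, -, rfl⟩; exact hE.quasiNormed.nonneg z hz⟩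
      ⟨y, hy, h.dominated hE hE1 hy, rfl⟩⟩

lemma rangeNorm_nonneg (hE : IsSymmetricQuasiBanach E N) (x : S01) : 0 ≤ rangeNorm E N x :=
  Real.sInf_nonneg (by rintro _ ⟨z, hz, -, rfl⟩; exact hE.quasiNormed.nonneg z hz)

/-- A near-minimizer is replaced by its rearrangement, which has the same norm and is nonnegative,
as adding majorants requires. -/
lemma exists_majorized_lt (hE : IsSymmetricQuasiBanach E N) (hE1 : SubsetL1 E) {x : S01}
    (hx : x ∈ rangeSpace E) {r : ℝ} (hr : rangeNorm E N x < r) :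
    ∃ y ∈ E, 0 ≤ y ∧ Majorized x y ∧ N y < r := by
  obtain ⟨y₀, hy₀, hd₀⟩ := hx.2
  have hne : {r : ℝ | ∃ y ∈ E, Dominated x y ∧ r = N y}.Nonempty := ⟨_, y₀, hy₀, hd₀, rfl⟩
  obtain ⟨_, ⟨y, hy, hd, rfl⟩, hlt⟩ := exists_lt_of_csInf_lt hne hr
  have h := hE.rearrClass_mem hy
  exact ⟨rearrClass y, h.1, rearrClass_nonneg y, hd.majorized hE hE1 hy, h.2.trans_lt hlt⟩

lemma rangeNorm_smul_le (hE : IsSymmetricQuasiBanach E N) (hE1 : SubsetL1 E) {x : S01}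
    (hx : x ∈ rangeSpace E) (c : ℝ) :
    c • x ∈ rangeSpace E ∧ rangeNorm E N (c • x) ≤ |c| * rangeNorm E N x := by
  have key : ∀ r > rangeNorm E N x,
      c • x ∈ rangeSpace E ∧ rangeNorm E N (c • x) ≤ |c| * r := fun r hr => by
    obtain ⟨y, hy, -, hm, hlt⟩ := exists_majorized_lt hE hE1 hx hr
    have h := rangeNorm_le hE hE1 (hE.quasiNormed.smul_mem |c| y hy) (hm.smul (hE1 y hy) c)
    rw [hE.quasiNormed.norm_smul _ _ hy, abs_abs] at h
    exact ⟨h.1, h.2.trans (mul_le_mul_of_nonneg_left hlt.le (abs_nonneg c))⟩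
  refine ⟨(key _ (lt_add_one _)).1, ?_⟩
  have hT : Tendsto (fun r => |c| * r) (𝓝[>] rangeNorm E N x) (𝓝 (|c| * rangeNorm E N x)) :=
    ((continuous_const.mul continuous_id).tendsto _).mono_left nhdsWithin_le_nhds
  exact ge_of_tendsto hT (eventually_nhdsWithin_of_forall fun r hr => (key r hr).2)

lemma rangeNorm_add_le (hE : IsSymmetricQuasiBanach E N) (hE1 : SubsetL1 E) {K : ℝ}
    (hK : 1 ≤ K) (hKt : ∀ x ∈ E, ∀ y ∈ E, N (x + y) ≤ K * (N x + N y)) {x₁ x₂ : S01}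
    (hx₁ : x₁ ∈ rangeSpace E) (hx₂ : x₂ ∈ rangeSpace E) :
    x₁ + x₂ ∈ rangeSpace E ∧
      rangeNorm E N (x₁ + x₂) ≤ 2 * K * (rangeNorm E N x₁ + rangeNorm E N x₂) := by
  have hq := hE.quasiNormed
  have hK0 : 0 < K := zero_lt_one.trans_le hK
  have key : ∀ ε > 0, x₁ + x₂ ∈ rangeSpace E ∧ rangeNorm E N (x₁ + x₂) ≤
      2 * K * ((rangeNorm E N x₁ + ε) + (rangeNorm E N x₂ + ε)) := fun ε hε => by
    obtain ⟨y₁, hy₁, hp₁, hm₁, hlt₁⟩ := exists_majorized_lt hE hE1 hx₁ (lt_add_of_pos_right _ hε)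
    obtain ⟨y₂, hy₂, hp₂, hm₂, hlt₂⟩ := exists_majorized_lt hE hE1 hx₂ (lt_add_of_pos_right _ hε)
    have hy := hq.add_mem _ hy₁ _ hy₂
    have h := rangeNorm_le hE hE1 (hq.smul_mem 2 _ hy)
      (hm₁.add hm₂ (hE1 _ hy₁) (hE1 _ hy₂) hp₁ hp₂)
    rw [hq.norm_smul _ _ hy, abs_two] at h
    refine ⟨h.1, h.2.trans ?_⟩
    rw [mul_assoc]
    refine mul_le_mul_of_nonneg_left ((hKt _ hy₁ _ hy₂).trans ?_) zero_le_two
    gcongr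
  refine ⟨(key 1 one_pos).1, ?_⟩
  have hT : Tendsto (fun ε => 2 * K * ((rangeNorm E N x₁ + ε) + (rangeNorm E N x₂ + ε)))
      (𝓝[>] 0) (𝓝 (2 * K * ((rangeNorm E N x₁ + 0) + (rangeNorm E N x₂ + 0)))) :=
    (Continuous.tendsto (by fun_prop) 0).mono_left nhdsWithin_le_nhds
  rw [add_zero, add_zero] at hT
  exact ge_of_tendsto hT (eventually_nhdsWithin_of_forall fun ε hε => (key ε hε).2)

lemma eq_zero_of_rangeNorm_eq_zero (hE : IsSymmetricQuasiBanach E N) (hE1 : SubsetL1 E)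
    {x : S01} (hx : x ∈ rangeSpace E) (h0 : rangeNorm E N x = 0) : x = 0 := by
  obtain ⟨C, hC, hCb⟩ := hE.exists_integral_abs_le hE1
  refine eq_zero_of_rearr_eq_zero fun t ht => le_antisymm ?_ (rearr_nonneg x t)
  have key : ∀ ε > 0, t * rearr x t ≤ C * ε := fun ε hε => by
    obtain ⟨y, hy, -, hm, hlt⟩ := exists_majorized_lt hE hE1 hx (h0.trans_lt hε)
    exact (hm.mul_rearr_le (hE1 y hy) ht).trans
      ((hCb y hy).trans (mul_le_mul_of_nonneg_left hlt.le hC))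
  have hT : Tendsto (fun ε => C * ε) (𝓝[>] 0) (𝓝 (C * 0)) :=
    (Continuous.tendsto (by fun_prop) 0).mono_left nhdsWithin_le_nhds
  have h1 := ge_of_tendsto hT (eventually_nhdsWithin_of_forall fun ε hε => key ε hε)
  rw [mul_zero] at h1
  exact nonpos_of_mul_nonpos_right h1 ht.1

lemma zero_mem_rangeSpace (hE : IsSymmetricQuasiBanach E N) (hE1 : SubsetL1 E) :
    (0 : S01) ∈ rangeSpace E ∧ rangeNorm E N 0 = 0 := by
  have h := rangeNorm_le hE hE1 hE.quasiNormed.zero_mem majorized_zero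
  rw [hE.quasiNormed.norm_zero] at h
  exact ⟨h.1, le_antisymm h.2 (rangeNorm_nonneg hE 0)⟩

lemma isQuasiNormed_rangeSpace (hE : IsSymmetricQuasiBanach E N) (hE1 : SubsetL1 E) :
    IsQuasiNormed (rangeSpace E) (rangeNorm E N) where
  zero_mem := (zero_mem_rangeSpace hE hE1).1
  add_mem x hx y hy := by
    obtain ⟨K, hK, hKt⟩ := hE.quasiNormed.exists_one_le
    exact (rangeNorm_add_le hE hE1 hK hKt hx hy).1
  smul_mem c x hx := (rangeNorm_smul_le hE hE1 hx c).1
  nonneg x _ := rangeNorm_nonneg hE x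
  eq_zero_iff x hx := by
    refine ⟨eq_zero_of_rangeNorm_eq_zero hE hE1 hx, ?_⟩
    rintro rfl
    exact (zero_mem_rangeSpace hE hE1).2
  norm_smul c x hx := by
    have h := rangeNorm_smul_le hE hE1 hx c
    refine le_antisymm h.2 ?_
    rcases eq_or_ne c 0 with rfl | hc
    · simpa using rangeNorm_nonneg hE _
    -- The reverse inequality is the same bound applied to c • x with the scalar c⁻¹.
    have h2 := (rangeNorm_smul_le hE hE1 h.1 c⁻¹).2
    rw [inv_smul_smul₀ hc, abs_inv, inv_mul_eq_div, le_div_iff₀ (abs_pos.2 hc)] at h2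
    linarith
  quasi_triangle := by
    obtain ⟨K, hK, hKt⟩ := hE.quasiNormed.exists_one_le
    exact ⟨2 * K, fun x hx y hy => (rangeNorm_add_le hE hE1 hK hKt hx hy).2⟩

lemma rangeNorm_le_of_rearr_le {x y : S01} (hE : IsSymmetricQuasiBanach E N) (hE1 : SubsetL1 E)
    (hx : x ∈ rangeSpace E) (h : ∀ t ∈ Ioo (0 : ℝ) 1, rearr y t ≤ rearr x t) :
    y ∈ rangeSpace E ∧ rangeNorm E N y ≤ rangeNorm E N x := by
  have key : ∀ r > rangeNorm E N x, y ∈ rangeSpace E ∧ rangeNorm E N y ≤ r := fun r hr => by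
    obtain ⟨z, hz, -, hm, hlt⟩ := exists_majorized_lt hE hE1 hx hr
    have h1 := rangeNorm_le hE hE1 hz (x := y) fun t ht => (h t ht).trans (hm t ht)
    exact ⟨h1.1, h1.2.trans hlt.le⟩
  exact ⟨(key _ (lt_add_one _)).1, le_of_forall_gt_imp_ge_of_dense fun r hr => (key r hr).2⟩

/-! ### Completeness and optimality -/

/-- Borel–Cantelli: the k-th increment exceeds C·2⁻ᵏ only on a set of measure at most 2^(−k−1), so
almost everywhere the increments are eventually dominated by a geometric series. -/
lemma exists_tendsto_ae_of_rearr_le {v : ℕ → S01} {C : ℝ}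
    (h : ∀ k, rearr (v (k + 1) - v k) ((1 / 2) ^ (k + 1)) ≤ C * (1 / 2) ^ k) :
    ∃ x : S01, ∀ᵐ u ∂leb, Tendsto (fun n => v n u) atTop (𝓝 (x u)) := by
  have hC : ∀ k : ℕ, 0 ≤ C * (1 / 2) ^ k := fun k => (rearr_nonneg _ _).trans (h k)
  have hm : ∀ k, leb {u : ℝ | C * (1 / 2) ^ k < |(v (k + 1) - v k) u|} ≤
      ENNReal.ofReal ((1 / 2) ^ (k + 1)) := fun k =>
    (rearr_le_iff _ (by positivity) (hC k)).1 (h k)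
  have hsum : Summable fun k : ℕ => (1 / 2 : ℝ) ^ k := summable_geometric_two
  have hfin : ∑' k, leb {u : ℝ | C * (1 / 2) ^ k < |(v (k + 1) - v k) u|} ≠ ⊤ :=
    ne_top_of_le_ne_top ((summable_nat_add_iff 1).2 hsum).tsum_ofReal_ne_top
      (ENNReal.tsum_le_tsum hm)
  have hcoe : ∀ᵐ u ∂leb, ∀ k, (v (k + 1) - v k) u = v (k + 1) u - v k u :=
    ae_all_iff.2 fun k => AEEqFun.coeFn_sub _ _
  have hlim : ∀ᵐ u ∂leb, ∃ l, Tendsto (fun n => v n u) atTop (𝓝 l) := by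
    filter_upwards [ae_eventually_notMem hfin, hcoe] with u hu hc
    refine cauchySeq_tendsto_of_complete (cauchySeq_of_summable_dist ?_)
    refine Summable.of_norm_bounded_eventually_nat (hsum.mul_left C) ?_
    filter_upwards [hu] with k hk
    rw [Real.norm_of_nonneg dist_nonneg, dist_comm, Real.dist_eq, ← hc k]
    exact not_lt.1 hk
  obtain ⟨f, hf, hfl⟩ := exists_stronglyMeasurable_limit_of_tendsto_ae
    (fun n => (v n).aestronglyMeasurable) hlim
  refine ⟨AEEqFun.mk f hf.aestronglyMeasurable, ?_⟩
  filter_upwards [hfl, AEEqFun.coeFn_mk f hf.aestronglyMeasurable] with u h1 h2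
  rwa [h2]

/-- The rate (4K)⁻ʲ times the weight 2^(j+1) is 2(2K)⁻ʲ, exactly the decay that
`exists_forall_sum_le` asks for. -/
lemma exists_majorized_series (hE : IsSymmetricQuasiBanach E N) (hE1 : SubsetL1 E) {K : ℝ}
    (hK : 1 ≤ K) (hKt : ∀ x ∈ E, ∀ y ∈ E, N (x + y) ≤ K * (N x + N y)) {d f : ℕ → S01}
    (hf : ∀ j, f j ∈ E) (hp : ∀ j, 0 ≤ f j) (hm : ∀ j, Majorized (d j) (f j)) {A : ℝ}
    (hA : 0 ≤ A) (hN : ∀ j, N (f j) ≤ A * ((4 * K)⁻¹) ^ j) :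
    ∃ Y ∈ E, (∀ m, Majorized (∑ j ∈ Finset.range m, d j) Y) ∧ N Y ≤ 4 * K ^ 2 * A := by
  have hq := hE.quasiNormed
  have hK0 : 0 < K := zero_lt_one.trans_le hK
  have hg : ∀ j, (2 : ℝ) ^ (j + 1) • f j ∈ E := fun j => hq.smul_mem _ _ (hf j)
  obtain ⟨Y, hY, hYs, hYN⟩ := hE.exists_forall_sum_le hK hKt hg
    (fun j => smul_nonneg_S01 (by positivity) (hp j)) (A := 2 * A) (by positivity) fun j => by
      rw [hq.norm_smul _ _ (hf j), abs_of_pos (by positivity)]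
      refine (mul_le_mul_of_nonneg_left (hN j) (by positivity)).trans_eq ?_
      have e : (2 * K)⁻¹ = 2 * (4 * K)⁻¹ := by field_simp; norm_num
      rw [e, mul_pow]
      ring
  refine ⟨Y, hY, fun m => ?_, hYN.trans_eq (by ring)⟩
  exact (Majorized.sum m hm (fun j => hE1 _ (hf j)) hp).mono
    (hE1 _ (hq.sum_mem hg m)) (hE1 Y hY) (hYs m)

lemma isQuasiComplete_rangeSpace (hE : IsSymmetricQuasiBanach E N) (hE1 : SubsetL1 E) :
    IsQuasiComplete (rangeSpace E) (rangeNorm E N) := by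
  intro u hu hcauchy
  have hq' := isQuasiNormed_rangeSpace hE hE1
  obtain ⟨K, hK, hKt⟩ := hE.quasiNormed.exists_one_le
  obtain ⟨K', hK', hKt'⟩ := hq'.exists_one_le
  obtain ⟨C, hC, hCb⟩ := hE.exists_integral_abs_le hE1
  have hK0 : 0 < K := zero_lt_one.trans_le hK
  obtain ⟨φ, hφ, hφc⟩ := extraction_forall_of_eventually
    (P := fun k i => ∀ m ≥ i, ∀ n ≥ i, rangeNorm E N (u m - u n) < ((4 * K)⁻¹) ^ k)
    fun k => by
      obtain ⟨n₀, hn₀⟩ := hcauchy (((4 * K)⁻¹) ^ k) (by positivity)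
      exact eventually_atTop.2
        ⟨n₀, fun i hi m hm n hn => hn₀ m (hi.trans hm) n (hi.trans hn)⟩
  set v : ℕ → S01 := fun k => u (φ k) with hv
  have hdlt : ∀ k, rangeNorm E N (v (k + 1) - v k) < ((4 * K)⁻¹) ^ k := fun k =>
    hφc k _ (hφ.monotone k.le_succ) _ le_rfl
  choose f hf hp hm hN using fun k =>
    exists_majorized_lt hE hE1 (hq'.sub_mem (hu (φ (k + 1))) (hu (φ k))) (hdlt k)
  -- With t = 2^(−k−1), the bound t·μ(t) ≤ C·4⁻ᵏ is divided by t. The exponent k + 1 keeps t < 1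
  -- when k = 0.
  have hrearr : ∀ k, rearr (v (k + 1) - v k) ((1 / 2) ^ (k + 1)) ≤ (2 * C) * (1 / 2) ^ k := by
    intro k
    have ht : (1 / 2 : ℝ) ^ (k + 1) ∈ Ioo (0 : ℝ) 1 :=
      ⟨by positivity, pow_lt_one₀ (by norm_num) (by norm_num) k.succ_ne_zero⟩
    have h1 := ((hm k).mul_rearr_le (hE1 _ (hf k)) ht).trans (hCb _ (hf k))
    have h2 : N (f k) ≤ (1 / 4) ^ k := by
      refine (hN k).le.trans (pow_le_pow_left₀ (by positivity) ?_ k)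
      rw [one_div]
      exact inv_anti₀ (by norm_num) (by linarith)
    have h3 : C * (1 / 4 : ℝ) ^ k = (1 / 2) ^ (k + 1) * (2 * C * (1 / 2) ^ k) := by
      rw [show (1 / 4 : ℝ) = 1 / 2 * (1 / 2) by norm_num, mul_pow]
      ring
    refine le_of_mul_le_mul_left (h1.trans ?_) ht.1
    rw [← h3]
    exact mul_le_mul_of_nonneg_left h2 hC
  obtain ⟨x, hx⟩ := exists_tendsto_ae_of_rearr_le hrearr
  have key : ∀ k, x - v k ∈ rangeSpace E ∧
      rangeNorm E N (x - v k) ≤ 4 * K ^ 2 * ((4 * K)⁻¹) ^ k := by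
    intro k
    obtain ⟨Y, hY, hYm, hYN⟩ := exists_majorized_series hE hE1 hK hKt (fun j => hf (k + j))
      (fun j => hp (k + j)) (fun j => hm (k + j)) (A := ((4 * K)⁻¹) ^ k) (by positivity)
      fun j => (hN (k + j)).le.trans_eq (pow_add _ _ _)
    have htel : ∀ m, ∑ j ∈ Finset.range m, (u (φ (k + j + 1)) - u (φ (k + j))) =
        v (k + m) - v k := fun m => Finset.sum_range_sub (fun j => v (k + j)) m
    -- One Y majorizes every partial sum v(k+m) − v(k), hence also their a.e. limit.
    have hmaj : Majorized (x - v k) Y := by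
      intro t ht
      refine rearr_le_of_tendsto_ae (v := fun m => v (k + m) - v k) ht.1 ?_ fun m => ?_
      · have hcoe : ∀ᵐ s ∂leb, ∀ m, (v (k + m) - v k) s = v (k + m) s - v k s :=
          ae_all_iff.2 fun m => AEEqFun.coeFn_sub _ _
        filter_upwards [hx, hcoe, AEEqFun.coeFn_sub x (v k)] with s h1 h2 h3
        simp only [h2]
        rw [h3, Pi.sub_apply]
        refine Tendsto.sub_const ?_ _
        have h4 := h1.comp (tendsto_add_atTop_nat k)
        simpa only [Function.comp_def, add_comm] using h4
      · rw [← htel m]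
        exact hYm m t ht
    have h := rangeNorm_le hE hE1 hY hmaj
    exact ⟨h.1, h.2.trans hYN⟩
  have hvE : ∀ k, v k ∈ rangeSpace E := fun k => hu (φ k)
  have hxE : x ∈ rangeSpace E := by
    have h := hq'.add_mem _ (key 0).1 _ (hvE 0)
    rwa [sub_add_cancel] at h
  refine ⟨x, hxE, ?_⟩
  have hpow : Tendsto (fun k : ℕ => 4 * K ^ 2 * ((4 * K)⁻¹) ^ k) atTop (𝓝 0) := by
    have := (tendsto_pow_atTop_nhds_zero_of_lt_one (r := (4 * K)⁻¹) (by positivity)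
      (inv_lt_one_of_one_lt₀ (by linarith))).const_mul (4 * K ^ 2)
    simpa using this
  have hK'0 : 0 < K' := zero_lt_one.trans_le hK'
  rw [Metric.tendsto_atTop]
  -- The whole sequence is compared with x through one far term v k; the two errors δ, multiplied by
  -- the quasi-triangle constant K', add up to ε.
  intro ε hε
  set δ := ε / (2 * K') with hδ
  have hδ0 : 0 < δ := by positivity
  obtain ⟨n₀, hn₀⟩ := hcauchy δ hδ0
  obtain ⟨k, hk, hkn⟩ := ((hpow.eventually_lt_const hδ0).and (eventually_ge_atTop n₀)).exists
  refine ⟨n₀, fun n hn => ?_⟩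
  have h1 := hKt' _ (hq'.sub_mem (hu n) (hvE k)) _ (hq'.sub_mem (hvE k) hxE)
  rw [sub_add_sub_cancel, hq'.norm_sub_comm (hvE k) hxE] at h1
  have h2 : rangeNorm E N (u n - v k) < δ := hn₀ n hn (φ k) (hkn.trans (hφ.id_le k))
  have h3 : rangeNorm E N (x - v k) < δ := (key k).2.trans_lt hk
  rw [Real.dist_eq, sub_zero, abs_of_nonneg (rangeNorm_nonneg hE _)]
  calc rangeNorm E N (u n - x) ≤ K' * (rangeNorm E N (u n - v k) + rangeNorm E N (x - v k)) := h1
    _ < K' * (δ + δ) := by gcongr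
    _ = ε := by rw [hδ]; field_simp; norm_num

lemma isSymmetricQuasiBanach_rangeSpace (hE : IsSymmetricQuasiBanach E N) (hE1 : SubsetL1 E) :
    IsSymmetricQuasiBanach (rangeSpace E) (rangeNorm E N) where
  quasiNormed := isQuasiNormed_rangeSpace hE hE1
  complete := isQuasiComplete_rangeSpace hE hE1
  solid _ hx _ hyx := rangeNorm_le_of_rearr_le hE hE1 hx fun _ ht =>
    rearr_le_rearr_of_abs_le hyx ht.1
  symmetric _ hx _ hyx := by
    have h := rangeNorm_le_of_rearr_le hE hE1 hx fun t ht => (hyx t ht).le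
    exact ⟨h.1, le_antisymm h.2
      (rangeNorm_le_of_rearr_le hE hE1 h.1 fun t ht => (hyx t ht).ge).2⟩

lemma calderonBounded_rangeSpace (hE : IsSymmetricQuasiBanach E N) (hE1 : SubsetL1 E) :
    CalderonBounded E N (rangeSpace E) (rangeNorm E N) := by
  refine ⟨1, fun x hx => ?_⟩
  have h := rangeNorm_le hE hE1 (hE.abs_mem hx).1 (majorized_calderon (hE1 x hx))
  exact ⟨h.1, h.2.trans ((hE.abs_mem hx).2.trans_eq (one_mul _).symm)⟩

lemma Dominated.rearrClass_le_calderon (hE : IsSymmetricQuasiBanach E N) (hE1 : SubsetL1 E)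
    {x y : S01} (hy : y ∈ E) (h : Dominated x y) :
    |rearrClass x| ≤ |calderon (rearrClass y)| := by
  have e : calderon (rearrClass y) =ᵐ[leb] calderonFun (rearrClass y) := AEEqFun.coeFn_mk _ _
  refine abs_le_abs_iff_ae.2 ?_
  filter_upwards [e, coeFn_rearrClass x, ae_leb_mem] with t h1 h2 ht
  rw [h1, h2, abs_of_nonneg (rearr_nonneg x t)]
  exact (h.majorized hE hE1 hy t ht).trans (le_abs_self _)

lemma continuouslyEmbedded_rangeSpace (hE : IsSymmetricQuasiBanach E N) (hE1 : SubsetL1 E)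
    {F : Set S01} {M : S01 → ℝ} (hF : IsSymmetricQuasiBanach F M)
    (hS : CalderonBounded E N F M) :
    ContinuouslyEmbedded (rangeSpace E) (rangeNorm E N) F M := by
  obtain ⟨C, hC⟩ := hS
  -- The given C may be negative, and passing to the infimum over y needs a nonnegative factor.
  refine ⟨max C 0, fun x hx => ?_⟩
  have step : ∀ y ∈ E, Dominated x y → x ∈ F ∧ M x ≤ max C 0 * N y := fun y hy hd => by
    have h := hE.rearrClass_mem hy
    obtain ⟨hmem, hM⟩ := hC _ h.1
    obtain ⟨hmem', hM'⟩ := hF.solid _ hmem _ (hd.rearrClass_le_calderon hE hE1 hy)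
    obtain ⟨hxF, hMx⟩ := hF.symmetric _ hmem' x fun t _ => (rearr_rearrClass x t).symm
    rw [h.2] at hM
    exact ⟨hxF, hMx.trans_le (hM'.trans (hM.trans
      (mul_le_mul_of_nonneg_right (le_max_left _ _) (hE.quasiNormed.nonneg y hy))))⟩
  obtain ⟨y₀, hy₀, hd₀⟩ := hx.2
  refine ⟨(step y₀ hy₀ hd₀).1, ?_⟩
  have hne : {r : ℝ | ∃ y ∈ E, Dominated x y ∧ r = N y}.Nonempty := ⟨_, y₀, hy₀, hd₀, rfl⟩
  have key : ∀ r > rangeNorm E N x, M x ≤ max C 0 * r := fun r hr => by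
    obtain ⟨_, ⟨y, hy, hd, rfl⟩, hlt⟩ := exists_lt_of_csInf_lt hne hr
    exact (step y hy hd).2.trans (mul_le_mul_of_nonneg_left hlt.le (le_max_right _ _))
  have hT : Tendsto (fun r => max C 0 * r) (𝓝[>] rangeNorm E N x)
      (𝓝 (max C 0 * rangeNorm E N x)) :=
    (Continuous.tendsto (by fun_prop) _).mono_left nhdsWithin_le_nhds
  exact ge_of_tendsto hT (eventually_nhdsWithin_of_forall key)

end CalderonRange

end

theorem mainTheorem4 (E : Set CalderonRange.S01) (N : CalderonRange.S01 → ℝ)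
    (hE : CalderonRange.IsSymmetricQuasiBanach E N) (hE1 : CalderonRange.SubsetL1 E) :
    CalderonRange.IsSymmetricQuasiBanach
        (CalderonRange.rangeSpace E) (CalderonRange.rangeNorm E N) ∧
      CalderonRange.IsOptimalRange E N
        (CalderonRange.rangeSpace E) (CalderonRange.rangeNorm E N) :=
  have h := CalderonRange.isSymmetricQuasiBanach_rangeSpace hE hE1
  ⟨h, h, CalderonRange.calderonBounded_rangeSpace hE hE1,
    fun _ _ hF hS => CalderonRange.continuouslyEmbedded_rangeSpace hE hE1 hF hS⟩
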